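/- Let $N\ge 1$ and $1\le L\le K$ be integers. Consider the $(N,K,L)$ cache-aided content delivery network: a server holds $N$ files of $1$ unit ($=F$ bits) each, there are $K$ caches of $M$ units each and $K$ users, and user $k$ reads the $L$ consecutive caches $k,k+1,\dots,k+L-1$ (indices modulo $K$). In the placement phase, before the requests are known, each cache stores at most $MF$ individual bits of the files (uncoded placement). Then every user requests one file, and the server broadcasts a message, which may be any function of all the files, such that every user recovers its requested file from the message and from the caches it reads. Let $R^*(M)$ be the optimal transmission rate under uncoded placement, i.e. the infimum of all $R$ such that for every $\varepsilon>0$ and all sufficiently large $F$ some uncoded placement allows every request pattern to be served by a message of at most $(R+\varepsilon)F$ bits. For an integer $w$ with $1\le w\le\lfloor K/L\rfloor$ let $\hat{\mathcal S}$ be the collection of all $w$-element subsets $s$ of $\{1,\dots,K\}$ such that $|a-b|\ge L$ and $|K-|a-b||\ge L$ for all distinct $a,b\in s$, let $\mathcal B$ be the set of all vectors $\mathbf b$ of $w+1$ non-negative integers with sum $K-wL-1$, let $\widehat{\mathbf b}$ be the largest component of $\mathbf b$, and set $$R_{\mathrm{new}}\Bigl(\frac{wN}{K}\Bigr)=\frac{\sum_{\mathbf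 b\in\mathcal B}\min\{2(K-wL)+w-1-\widehat{\mathbf b},\,K\}}{|\hat{\mathcal S}|\,(w+1)}.$$ If $L\ge K/2$, then at the memory point $M=N/K$ (that is, $w=1$), $$R^*(M)\le R_{\mathrm{new}}(M)\le\frac{5(K-L)(K-L+1)}{8K}.$$ -/

import Mathlib

namespace MACC

/-! ### The optimal rate of multi-access coded caching under uncoded placement

There are `N` files of `F` bits each (file size `1` unit `= F` bits), `K` caches and `K` users,
all indexed cyclically by `Fin K`; user `k` reads the `L` consecutive caches
`k, k + 1, …, k + L - 1` (with wrap-around). -/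

/-- A realization of the `N` files, each one a string of `F` bits. -/
abbrev Library (N F : ℕ) : Type := Fin N → Fin F → Bool

/-- An uncoded placement: every cache stores a set of individual bits of the files. The pair
`(n, j)` stands for the `j`-th bit of file `n`. -/
abbrev Placement (N K F : ℕ) : Type := Fin K → Finset (Fin N × Fin F)

/-- The cache at cyclic distance `r` after position `k`. -/
def cacheAt {K : ℕ} (k : Fin K) (r : ℕ) : Fin K :=
  ⟨(k.val + r) % K, Nat.mod_lt _ k.pos⟩

/-- The bits that user `k` reads from its `L` consecutive caches. -/
def accessible {N K F : ℕ} (L : ℕ) (Z : Placement N K F) (k : Fin K) : Set (Fin N × Fin F) :=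
  {p | ∃ r < L, p ∈ Z (cacheAt k r)}

/-- With placement `Z` and requests `d` (user `k` wants file `d k`), a broadcast message of `B`
bits, computed from the whole library, lets every user recover its requested file from the message
and from the cached bits it reads, whatever the contents of the files. The encoder and the decoders
may be arbitrary functions depending on `Z` and `d`. -/
def Delivers {N K F : ℕ} (L : ℕ) (Z : Placement N K F) (d : Fin K → Fin N) (B : ℕ) : Prop :=
  ∃ enc : Library N F → (Fin B → Bool),
    ∀ k : Fin K, ∃ dec : (Fin B → Bool) → (accessible L Z k → Bool) → (Fin F → Bool),
      ∀ W : Library N F, dec (enc W) (fun p => W p.val.1 p.val.2) = W (d k)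

/-- There is an uncoded placement, with caches of `M` units `= M * F` bits, for which every request
pattern can be served by a broadcast message of `B` bits. The placement is chosen before the
requests are known. -/
def Feasible (N K L F : ℕ) (M : ℝ) (B : ℕ) : Prop :=
  ∃ Z : Placement N K F, (∀ c, ((Z c).card : ℝ) ≤ M * F) ∧ ∀ d : Fin K → Fin N, Delivers L Z d B

/-- The rate `R` (in units of files) is achievable at cache size `M`: for every `ε > 0` and for
all sufficiently large file sizes `F`, messages of at most `(R + ε) * F` bits suffice. -/
def Achievable (N K L : ℕ) (M R : ℝ) : Prop :=
  ∀ ε > 0, ∀ᶠ F : ℕ in Filter.atTop, ∃ B : ℕ, (B : ℝ) ≤ (R + ε) * F ∧ Feasible N K L F M B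

/-- The optimal worst-case transmission rate `R*(M)` under uncoded placement. For `M ≥ 0`
it is the infimum of a nonempty set of reals that is bounded below by `0`, as shown next. -/
noncomputable def optimalRate (N K L : ℕ) (M : ℝ) : ℝ :=
  sInf {R : ℝ | Achievable N K L M R}

theorem achievable_nonempty (N K L : ℕ) {M : ℝ} (hM : 0 ≤ M) :
    {R : ℝ | Achievable N K L M R}.Nonempty := by
  refine ⟨N, fun ε hε => Filter.Eventually.of_forall fun F => ⟨N * F, ?_, ?_⟩⟩
  · push_cast
    exact mul_le_mul_of_nonneg_right (by linarith) (Nat.cast_nonneg F)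
  · refine ⟨fun _ => ∅, fun _ => ?_, fun d => ?_⟩
    · simp only [Finset.card_empty, Nat.cast_zero]
      positivity
    · refine ⟨fun W i => W (finProdFinEquiv.symm i).1 (finProdFinEquiv.symm i).2, fun k =>
        ⟨fun x _ j => x (finProdFinEquiv (d k, j)), fun W => ?_⟩⟩
      funext j
      simp

theorem achievable_bddBelow (N K L : ℕ) (M : ℝ) :
    BddBelow {R : ℝ | Achievable N K L M R} := by
  refine ⟨0, fun R hR => le_of_forall_pos_le_add fun ε hε => ?_⟩
  obtain ⟨F, ⟨B, hB, -⟩, hF⟩ := ((hR ε hε).and (Filter.eventually_gt_atTop 0)).exists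
  have h1 : (0 : ℝ) ≤ (R + ε) * F := (Nat.cast_nonneg B).trans hB
  have h2 : (0 : ℝ) < F := by exact_mod_cast hF
  exact nonneg_of_mul_nonneg_left h1 h2

/-! ### The rate `R_new` -/

/-- The collection `Ŝ` of the `w`-element sets of cache indices any two distinct elements `a, b`
of which satisfy `|a - b| ≥ L` and `|K - |a - b|| ≥ L`. -/
def separatedSets (K L w : ℕ) : Finset (Finset (Fin K)) :=
  (Finset.powersetCard w Finset.univ).filter fun s =>
    ∀ a ∈ s, ∀ b ∈ s, a ≠ b →
      (L : ℤ) ≤ |(a.val : ℤ) - b.val| ∧ (L : ℤ) ≤ |(K : ℤ) - (|(a.val : ℤ) - b.val|)|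

/-- The collection `𝓑` of the weak compositions of `K - w * L - 1` into `w + 1` parts, i.e. the
vectors of `w + 1` nonnegative integers with that sum (none if it is negative). The parts are
automatically smaller than `K`. -/
def gapVectors (K L w : ℕ) : Finset (Fin (w + 1) → ℕ) :=
  (Fintype.piFinset fun _ => Finset.range K).filter fun b => (∑ i, b i) + w * L + 1 = K

/-- The largest component of a vector. -/
def maxPart {m : ℕ} (b : Fin m → ℕ) : ℕ := Finset.univ.sup b

/-- The value of `R_new(M)` at the memory point `M = w * N / K`, which does not depend on `N`. -/
noncomputable def Rnew (K L w : ℕ) : ℝ :=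
  (∑ b ∈ gapVectors K L w,
      min (2 * ((K : ℝ) - w * L) + w - 1 - maxPart b) (K : ℝ)) /
    (((separatedSets K L w).card : ℝ) * (w + 1))

end MACC

namespace MACC

open Finset

/-! Write `D = K - L`. Subfile `c` of every file goes to cache `c`, so user `k` misses the `D`
subfiles at `k - 1, …, k - D`, and each subfile is cut into two halves. For `a + b = D + 1`, the
coded symbol at `u` adds a half of subfile `u - a` wanted by user `u` and a half of subfile `u`
wanted by user `u + b`. User `k` can compute all but at most `D + a` of these `K` symbols, so `D +
a` power moments at distinct field elements determine the rest by Vandermonde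
(`eq_zero_of_moments`), and two of them yield wanted halves (`codedSymbol_decode`). Taking `a` as
the smaller distance costs `D + min (i + 1) (D - i)` symbols in group `i`. For `K ≤ 2 * L` the
resulting rate is exactly `Rnew K L 1` (`Rnew_one`), and `four_mul_sum_groupSize_le` bounds it. -/

/-- A message taking values in any type with at most `2 ^ B` elements can be used as a broadcast of
`B` bits, and decodability means that the message and the accessible bits determine the request. -/
theorem delivers_of_determines {N K F L B : ℕ} {Z : Placement N K F} {d : Fin K → Fin N}
    {β : Type*} [Fintype β] (enc : Library N F → β) (hcard : Fintype.card β ≤ 2 ^ B)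
    (h : ∀ k W W', enc W = enc W' → (∀ p ∈ accessible L Z k, W p.1 p.2 = W' p.1 p.2) →
      W (d k) = W' (d k)) :
    Delivers L Z d B := by
  classical
  obtain ⟨f⟩ : Nonempty (β ↪ (Fin B → Bool)) :=
    Function.Embedding.nonempty_of_card_le (by simpa using hcard)
  refine ⟨fun W => f (enc W), fun k => ⟨fun m a =>
    if hex : ∃ W : Library N F, f (enc W) = m ∧
        (fun p : accessible L Z k => W p.val.1 p.val.2) = a
      then hex.choose (d k) else fun _ => false, fun W => ?_⟩⟩
  have hex : ∃ W' : Library N F, f (enc W') = f (enc W) ∧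
      (fun p : accessible L Z k => W' p.val.1 p.val.2) = fun p => W p.val.1 p.val.2 :=
    ⟨W, rfl, rfl⟩
  change (dite _ _ _ : Fin F → Bool) = _
  rw [dif_pos hex]
  exact h k _ _ (f.injective hex.choose_spec.1) fun p hp => congrFun hex.choose_spec.2 ⟨p, hp⟩

/-! ### Decoding from power moments -/

/-- A vector supported on at most `n` indices is determined by its first `n` power moments at
distinct nodes. -/
theorem eq_zero_of_moments {ι E : Type*} [Fintype ι] [DecidableEq ι] [Field E] {x : ι → E}
    (hx : Function.Injective x) {I : Finset ι} {n : ℕ} (hI : I.card ≤ n) {z : ι → E}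
    (hz : ∀ i ∉ I, z i = 0) (hmom : ∀ e < n, ∑ i, x i ^ e * z i = 0) : z = 0 := by
  have hpoly : ∀ p : Polynomial E, p.natDegree < n → ∑ i, p.eval (x i) * z i = 0 := by
    intro p hp
    simp_rw [Polynomial.eval_eq_sum_range' hp, sum_mul]
    rw [sum_comm]
    refine sum_eq_zero fun e he => ?_
    simp_rw [mul_assoc]
    rw [← mul_sum, hmom e (mem_range.1 he), mul_zero]
  funext k
  by_cases hk : k ∈ I
  -- This product vanishes on `I` except at `k`, and `z` vanishes off `I`, so testing against it
  -- isolates `z k`.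
  · have hdeg : (∏ i ∈ I.erase k, (Polynomial.X - Polynomial.C (x i))).natDegree < n := by
      rw [Polynomial.natDegree_prod_of_monic _ _ fun i _ => Polynomial.monic_X_sub_C _]
      simp only [Polynomial.natDegree_X_sub_C, sum_const, smul_eq_mul, mul_one]
      exact (card_erase_lt_of_mem hk).trans_le hI
    have h := hpoly _ hdeg
    rw [sum_eq_single k] at h
    · refine (mul_eq_zero.1 h).resolve_left ?_
      rw [Polynomial.eval_prod]
      refine prod_ne_zero_iff.2 ?_
      intro i hi
      simpa [sub_eq_zero] using fun h => (ne_of_mem_erase hi) (hx h).symm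
    · intro i _ hik
      by_cases hi : i ∈ I
      · rw [Polynomial.eval_prod, prod_eq_zero (mem_erase.2 ⟨hik, hi⟩) (by simp), zero_mul]
      · rw [hz i hi, mul_zero]
    · simp
  · exact hz k hk

theorem cacheAt_cacheAt {K : ℕ} (k : Fin K) (a b : ℕ) :
    cacheAt (cacheAt k a) b = cacheAt k (a + b) := by
  ext
  simp [cacheAt, add_assoc]

theorem cacheAt_add_self {K : ℕ} (k : Fin K) (a : ℕ) : cacheAt k (a + K) = cacheAt k a := by
  ext
  simp [cacheAt, ← add_assoc]

theorem cacheAt_zero {K : ℕ} (k : Fin K) : cacheAt k 0 = k := by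
  ext
  simp [cacheAt, Nat.mod_eq_of_lt k.isLt]

theorem exists_eq_cacheAt {K : ℕ} (k c : Fin K) : ∃ r < K, c = cacheAt k r := by
  refine ⟨(c.val + (K - k.val)) % K, Nat.mod_lt _ k.pos, ?_⟩
  ext
  simp only [cacheAt, Nat.add_mod_mod]
  rw [show k.val + (c.val + (K - k.val)) = c.val + K by omega, Nat.add_mod_right,
    Nat.mod_eq_of_lt c.isLt]

/-- The coded symbol at position `u`, formed from the symbols `Y n c` of subfile `c` of file `n`:
user `u` wants the first summand, the user at distance `b` after `u` the second one. -/
def codedSymbol {N K : ℕ} {E : Type*} [Add E] (d : Fin K → Fin N) (a b : ℕ)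
    (Y Y' : Fin N → Fin K → E) (u : Fin K) : E :=
  Y (d u) (cacheAt u (K - a)) + Y' (d (cacheAt u b)) u

/-- If two pairs of symbol families have the same first `K - L + a` moments of their coded symbols
and agree on the caches read by user `k`, then the symbols wanted by user `k` agree. -/
theorem codedSymbol_decode {N K L : ℕ} {E : Type*} [Field E] (hL : 1 ≤ L) (hLK : L ≤ K)
    {x : Fin K → E} (hx : Function.Injective x) (d : Fin K → Fin N) {a b : ℕ}
    (hab : a + b = K - L + 1) (ha : 1 ≤ a) (hb : 1 ≤ b)
    {Y Y' V V' : Fin N → Fin K → E}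
    (k : Fin K) (hY : ∀ n, ∀ r < L, Y n (cacheAt k r) = V n (cacheAt k r))
    (hY' : ∀ n, ∀ r < L, Y' n (cacheAt k r) = V' n (cacheAt k r))
    (hmom : ∀ e < K - L + a, ∑ u, x u ^ e * codedSymbol d a b Y Y' u =
      ∑ u, x u ^ e * codedSymbol d a b V V' u) :
    Y (d k) (cacheAt k (K - a)) = V (d k) (cacheAt k (K - a)) ∧
      Y' (d k) (cacheAt k (K - b)) = V' (d k) (cacheAt k (K - b)) := by
  -- Positions where a summand may be unknown: the second one at distances `L, …, K - 1` after `k`,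
  -- the first one at distances `L + a, …, K + a - 1`.
  set I : Finset (Fin K) := (range (K - L + a)).image fun i => cacheAt k (L + i) with hI
  have hz := eq_zero_of_moments hx (I := I) (n := K - L + a)
    (z := fun u => codedSymbol d a b Y Y' u - codedSymbol d a b V V' u)
    (card_image_le.trans_eq (card_range _)) (fun u hu => ?_) (fun e he => ?_)
  · constructor
    · have h := congrFun hz k
      have h0 := hY' (d (cacheAt k b)) 0 hL
      rw [cacheAt_zero] at h0
      simpa [codedSymbol, h0, sub_eq_zero] using h
    -- At `u = k - b` the other summand uses subfile `k - b - a`, which is `k + L - 1`, the last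
    -- cache that user `k` reads. At `u = k` above, it was the first cache.
    · have h := congrFun hz (cacheAt k (K - b))
      have h0 := hY (d (cacheAt k (K - b))) (L - 1) (by omega)
      have h1 : cacheAt (cacheAt k (K - b)) (K - a) = cacheAt k (L - 1) := by
        rw [cacheAt_cacheAt, show K - b + (K - a) = L - 1 + K by omega, cacheAt_add_self]
      have h2 : cacheAt (cacheAt k (K - b)) b = k := by
        rw [cacheAt_cacheAt, show K - b + b = 0 + K by omega, cacheAt_add_self, cacheAt_zero]
      simpa [codedSymbol, h1, h2, h0, sub_eq_zero] using h
  · have hu' : ∀ i < K - L + a, cacheAt k (L + i) ≠ u := fun i hi h =>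
      hu (mem_image.2 ⟨i, mem_range.2 hi, h⟩)
    have h1 : Y' (d (cacheAt u b)) u = V' (d (cacheAt u b)) u := by
      obtain ⟨r, hr, hur⟩ := exists_eq_cacheAt k u
      rcases lt_or_ge r L with h | h
      · rw [hur]; exact hY' _ r h
      · exact absurd (by rw [hur, show L + (r - L) = r by omega]) (hu' (r - L) (by omega))
    have h2 : Y (d u) (cacheAt u (K - a)) = V (d u) (cacheAt u (K - a)) := by
      obtain ⟨r, hr, hur⟩ := exists_eq_cacheAt k (cacheAt u (K - a))
      rcases lt_or_ge r L with h | h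
      · rw [hur]; exact hY _ r h
      · refine absurd ?_ (hu' (r - L + a) (by omega))
        rw [show L + (r - L + a) = r + a by omega, ← cacheAt_cacheAt, ← hur, cacheAt_cacheAt,
          show K - a + a = 0 + K by omega, cacheAt_add_self, cacheAt_zero]
    simp [codedSymbol, h1, h2]
  · simp_rw [mul_sub]
    rw [sum_sub_distrib, hmom e he, sub_self]

/-! ### The scheme and its rate -/

/-- The number of coded symbols sent per pair of half-subfiles at distances `i + 1` and
`D - i` before the user, for `D` missing subfiles per user. -/
def groupSize (D i : ℕ) : ℕ := D + min (i + 1) (D - i)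

/-- The coded caching scheme: each file consists of `K` subfiles of `2 * t` symbols of `s` bits,
and of `r` further bits that are not cached. -/
theorem feasible_scheme {N K L : ℕ} (hL : 1 ≤ L) (hLK : L ≤ K) {E : Type*} [Field E] [Fintype E]
    {s : ℕ} (φ : (Fin s → Bool) ≃ E) {x : Fin K → E} (hx : Function.Injective x) (t r F : ℕ)
    (hF : K * (2 * (t * s)) + r = F) {M : ℝ} (hM : ((N * (2 * (t * s)) : ℕ) : ℝ) ≤ M * F) :
    Feasible N K L F M (t * s * (∑ i ∈ range (K - L), groupSize (K - L) i) + K * r) := by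
  classical
  obtain ⟨e⟩ : Nonempty ((Fin K × Bool × Fin t × Fin s) ⊕ Fin r ≃ Fin F) :=
    ⟨Fintype.equivOfCardEq (by simp [← hF])⟩
  let Z : Placement N K F := fun c => (univ : Finset (Fin N × Bool × Fin t × Fin s)).image
    fun q => (q.1, e (Sum.inl (c, q.2)))
  refine ⟨Z, fun c => le_trans ?_ hM, fun d => ?_⟩
  · exact_mod_cast card_image_le.trans_eq (by simp)
  let Y : Library N F → Bool → Fin t → Fin N → Fin K → E := fun W h τ n c =>
    φ fun l => W n (e (Sum.inl (c, h, τ, l)))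
  -- Group `i` always carries the `true` half at distance `i + 1` and the `false` half at distance
  -- `K - L - i`. `side` only puts the half with the smaller distance in the role of `a`, which sets
  -- the number of moments.
  let m : ℕ → ℕ := fun i => min (i + 1) (K - L - i)
  let m' : ℕ → ℕ := fun i => max (i + 1) (K - L - i)
  let side : ℕ → Bool := fun i => decide (i + 1 ≤ K - L - i)
  refine delivers_of_determines
    (β := ((Fin t × Σ i : Fin (K - L), Fin (groupSize (K - L) i)) → E) ×
      (Fin K → Fin r → Bool))
    (fun W => (fun q => ∑ u, x u ^ (q.2.2 : ℕ) *
        codedSymbol d (m q.2.1) (m' q.2.1) (Y W (side q.2.1) q.1) (Y W (!side q.2.1) q.1) u,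
      fun k j => W (d k) (e (Sum.inr j)))) ?_ ?_
  · have hE : Fintype.card E = 2 ^ s := by simp [← Fintype.card_congr φ]
    simp only [Fintype.card_prod, Fintype.card_fun, Fintype.card_sigma, Fintype.card_fin,
      Fintype.card_bool, hE]
    rw [Fin.sum_univ_eq_sum_range (groupSize (K - L)), ← pow_mul, ← pow_mul, ← pow_add]
    exact (congrArg (2 ^ ·) (by ring)).le
  intro k W W' henc hacc
  have hY : ∀ h τ n, ∀ q < L, Y W h τ n (cacheAt k q) = Y W' h τ n (cacheAt k q) := by
    intro h τ n q hq
    refine congrArg φ (funext fun l => hacc (n, _) ⟨q, hq, ?_⟩)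
    exact mem_image.2 ⟨(n, h, τ, l), mem_univ _, rfl⟩
  have hgroup : ∀ τ, ∀ i < K - L,
      Y W (side i) τ (d k) (cacheAt k (K - m i)) = Y W' (side i) τ (d k) (cacheAt k (K - m i)) ∧
      Y W (!side i) τ (d k) (cacheAt k (K - m' i)) =
        Y W' (!side i) τ (d k) (cacheAt k (K - m' i)) := by
    intro τ i hi
    refine codedSymbol_decode hL hLK hx d (a := m i) (b := m' i) ?_ ?_ ?_ k
      (hY _ τ) (hY _ τ) fun ν hν => ?_
    · simp only [m, m']; omega
    · simp only [m]; omega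
    · simp only [m']; omega
    · exact congrFun (congrArg Prod.fst henc) (τ, ⟨⟨i, hi⟩, ⟨ν, hν⟩⟩)
  have hall : ∀ h τ c, Y W h τ (d k) c = Y W' h τ (d k) c := by
    intro h τ c
    obtain ⟨q, hq, rfl⟩ := exists_eq_cacheAt k c
    rcases lt_or_ge q L with hqL | hqL
    · exact hY h τ _ q hqL
    -- the first half of a subfile is sent in the group of its distance, the second half
    -- in the group of the complementary distance
    obtain ⟨i, hi, hcase⟩ : ∃ i < K - L, (side i = h ∧ K - m i = q) ∨
        ((!side i) = h ∧ K - m' i = q) := by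
      cases h
      · refine ⟨q - L, by omega, ?_⟩
        rcases le_or_gt (q - L + 1) (K - L - (q - L)) with hc | hc
        · right; simp only [side, m', decide_eq_true hc]; exact ⟨by simp, by omega⟩
        · left; simp only [side, m, decide_eq_false hc.not_ge]; exact ⟨by simp, by omega⟩
      · refine ⟨K - q - 1, by omega, ?_⟩
        rcases le_or_gt (K - q - 1 + 1) (K - L - (K - q - 1)) with hc | hc
        · left; simp only [side, m, decide_eq_true hc]; exact ⟨by simp, by omega⟩
        · right; simp only [side, m', decide_eq_false hc.not_ge]; exact ⟨by simp, by omega⟩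
    rcases hcase with ⟨rfl, rfl⟩ | ⟨rfl, rfl⟩
    · exact (hgroup τ i hi).1
    · exact (hgroup τ i hi).2
  funext p
  obtain ⟨q, rfl⟩ := e.surjective p
  rcases q with ⟨c, h, τ, l⟩ | j
  · exact congrFun (φ.injective (hall h τ c)) l
  · exact congrFun (congrFun (congrArg Prod.snd henc) k) j

theorem achievable_groupSize {N K L : ℕ} (hL : 1 ≤ L) (hLK : L ≤ K) :
    Achievable N K L ((N : ℝ) / K)
      ((∑ i ∈ range (K - L), groupSize (K - L) i : ℕ) / (2 * K : ℝ)) := by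
  intro ε hε
  have hK : K ≠ 0 := by omega
  have hK' : (0 : ℝ) < K := by exact_mod_cast Nat.pos_of_ne_zero hK
  have : Fact (Nat.Prime 2) := ⟨Nat.prime_two⟩
  let _ : Fintype (GaloisField 2 K) := Fintype.ofFinite _
  have hcard : Fintype.card (GaloisField 2 K) = 2 ^ K := by
    rw [← Nat.card_eq_fintype_card, GaloisField.card 2 K hK]
  obtain ⟨φ⟩ : Nonempty ((Fin K → Bool) ≃ GaloisField 2 K) :=
    ⟨Fintype.equivOfCardEq (by simp [hcard])⟩
  obtain ⟨x⟩ : Nonempty (Fin K ↪ GaloisField 2 K) :=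
    Function.Embedding.nonempty_of_card_le (by simpa [hcard] using Nat.lt_two_pow_self.le)
  have hlarge : ∀ᶠ F : ℕ in Filter.atTop, (K * (2 * K * K) : ℝ) / ε ≤ F :=
    tendsto_natCast_atTop_atTop.eventually_ge_atTop _
  filter_upwards [hlarge] with F hFε
  set S := ∑ i ∈ range (K - L), groupSize (K - L) i
  -- There are `2 * K` half-subfiles per file and `K` bits per symbol of the field with `2 ^ K`
  -- elements. The bounded remainder `r` is sent uncoded, and its cost is absorbed by `ε`.
  set t := F / (2 * K * K)
  set r := F % (2 * K * K)
  have hdiv : 2 * K * K * t + r = F := Nat.div_add_mod F _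
  have hr : r < 2 * K * K := Nat.mod_lt _ (by positivity)
  have hdivR : (2 * K * K * t + r : ℝ) = F := by exact_mod_cast hdiv
  have hrR : (r : ℝ) ≤ 2 * K * K := by exact_mod_cast hr.le
  have hr0 : (0 : ℝ) ≤ r := Nat.cast_nonneg r
  have hbits : ((t * K : ℕ) : ℝ) ≤ F / (2 * K) := by
    rw [le_div_iff₀ (by positivity)]
    push_cast
    linarith
  refine ⟨t * K * S + K * r, ?_, feasible_scheme hL hLK φ x.injective t r F ?_ ?_⟩
  · have h1 : ((t * K : ℕ) : ℝ) * S ≤ F / (2 * K) * S :=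
      mul_le_mul_of_nonneg_right hbits (Nat.cast_nonneg _)
    have h2 : (K : ℝ) * r ≤ ε * F := by
      rw [div_le_iff₀ hε] at hFε
      nlinarith
    calc ((t * K * S + K * r : ℕ) : ℝ) = ((t * K : ℕ) : ℝ) * S + K * r := by push_cast; ring
      _ ≤ F / (2 * K) * S + ε * F := add_le_add h1 h2
      _ = (S / (2 * K) + ε) * F := by ring
  · rw [← hdiv]; ring
  · calc ((N * (2 * (t * K)) : ℕ) : ℝ) = N * (2 * ((t * K : ℕ) : ℝ)) := by push_cast; ring
      _ ≤ N * (2 * (F / (2 * K))) := by gcongr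
      _ = N / K * F := by field_simp

/-! ### Evaluating and bounding `Rnew K L 1` -/

theorem card_separatedSets_one (K L : ℕ) : (separatedSets K L 1).card = K := by
  rw [separatedSets, filter_true_of_mem, card_powersetCard, card_univ, Fintype.card_fin,
    Nat.choose_one_right]
  intro s hs a ha b hb hab
  obtain ⟨c, rfl⟩ := card_eq_one.1 (mem_powersetCard.1 hs).2
  exact absurd ((mem_singleton.1 ha).trans (mem_singleton.1 hb).symm) hab

theorem sum_gapVectors_one {K L : ℕ} (hL : 1 ≤ L) (hLK : L ≤ K) (f : (Fin 2 → ℕ) → ℝ) :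
    ∑ b ∈ gapVectors K L 1, f b = ∑ i ∈ range (K - L), f ![i, K - L - 1 - i] := by
  refine sum_nbij' (fun b => b 0) (fun i => ![i, K - L - 1 - i]) ?_ ?_ ?_ ?_ ?_
  · intro b hb
    have h := (mem_filter.1 hb).2
    rw [Fin.sum_univ_two] at h
    exact mem_range.2 (by omega)
  · intro i hi
    have hi := mem_range.1 hi
    refine mem_filter.2 ⟨Fintype.mem_piFinset.2 fun j => mem_range.2 ?_, ?_⟩
    · fin_cases j
      · change i < K; omega
      · change K - L - 1 - i < K; omega
    · rw [Fin.sum_univ_two]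
      change i + (K - L - 1 - i) + 1 * L + 1 = K
      omega
  · intro b hb
    have h := (mem_filter.1 hb).2
    rw [Fin.sum_univ_two] at h
    funext j
    fin_cases j
    · rfl
    · change K - L - 1 - b 0 = b 1; omega
  · intro i _; rfl
  · intro b hb
    have h := (mem_filter.1 hb).2
    rw [Fin.sum_univ_two] at h
    congr 1
    funext j
    fin_cases j
    · rfl
    · change b 1 = K - L - 1 - b 0; omega

/-- With `D = K - L`, `K ≤ 2 * L` gives `2 * D ≤ K`, so the first argument of the minimum wins, and
`2 * D - max i (D - 1 - i) = D + min (i + 1) (D - i)`. -/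
theorem Rnew_one {K L : ℕ} (hL : 1 ≤ L) (hLK : L ≤ K) (hKL : K ≤ 2 * L) :
    Rnew K L 1 = (∑ i ∈ range (K - L), groupSize (K - L) i : ℕ) / (2 * K : ℝ) := by
  rw [Rnew, card_separatedSets_one, sum_gapVectors_one hL hLK]
  push_cast
  congr 1
  · refine sum_congr rfl fun i hi => ?_
    have hi := mem_range.1 hi
    have hmax : maxPart ![i, K - L - 1 - i] = max i (K - L - 1 - i) := by
      simp [maxPart, Fin.univ_succ]
    have hsize : groupSize (K - L) i + max i (K - L - 1 - i) + 2 * L = 2 * K := by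
      simp only [groupSize]; omega
    have hle : 2 * K ≤ K + max i (K - L - 1 - i) + 2 * L := by omega
    have h1 : (groupSize (K - L) i + (max i (K - L - 1 - i) : ℕ) + 2 * L : ℝ) = 2 * K := by
      exact_mod_cast hsize
    have h2 : (2 * K : ℝ) ≤ K + (max i (K - L - 1 - i) : ℕ) + 2 * L := by exact_mod_cast hle
    rw [hmax, min_eq_left (by linarith)]
    linarith
  · ring

/-- Induction in steps of two: from `D` to `D + 2` each old minimum grows by one and two end terms
equal to one appear. -/
theorem four_mul_sum_groupSize_le :
    ∀ D : ℕ, 4 * ∑ i ∈ range D, groupSize D i ≤ 5 * D * (D + 1)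
  | 0 => by simp
  | 1 => by simp [groupSize]
  | D + 2 => by
    have ih := four_mul_sum_groupSize_le D
    simp only [groupSize, sum_add_distrib, sum_const, card_range, smul_eq_mul] at ih ⊢
    have hmid : ∑ i ∈ range D, min (i + 1 + 1) (D + 2 - (i + 1)) =
        ∑ i ∈ range D, min (i + 1) (D - i) + D := by
      calc _ = ∑ i ∈ range D, (min (i + 1) (D - i) + 1) :=
            sum_congr rfl fun i hi => by have := mem_range.1 hi; omega
        _ = _ := by simp [sum_add_distrib]
    rw [sum_range_succ', sum_range_succ, hmid]
    have h1 : min (D + 1 + 1) (D + 2 - (D + 1)) = 1 := by omega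
    have h2 : min (0 + 1) (D + 2 - 0) = 1 := by omega
    rw [h1, h2]
    nlinarith

end MACC

theorem corollary8 (N K L : ℕ) (hN : 1 ≤ N) (hK : 1 ≤ K) (hLK : L ≤ K)
    (hL : (K : ℝ) / 2 ≤ (L : ℝ)) :
    MACC.optimalRate N K L ((N : ℝ) / (K : ℝ)) ≤ MACC.Rnew K L 1 ∧
      MACC.Rnew K L 1 ≤ 5 * ((K : ℝ) - L) * ((K : ℝ) - L + 1) / (8 * (K : ℝ)) := by
  have hKL : K ≤ 2 * L := by
    have h : (K : ℝ) ≤ 2 * L := by linarith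
    exact_mod_cast h
  have hL1 : 1 ≤ L := by omega
  rw [MACC.Rnew_one hL1 hLK hKL]
  refine ⟨csInf_le (MACC.achievable_bddBelow N K L _) (MACC.achievable_groupSize hL1 hLK), ?_⟩
  have hK0 : (0 : ℝ) < K := by exact_mod_cast hK
  have h : (4 * (∑ i ∈ Finset.range (K - L), MACC.groupSize (K - L) i : ℕ) : ℝ) ≤
      5 * (K - L : ℕ) * ((K - L : ℕ) + 1) := by
    exact_mod_cast MACC.four_mul_sum_groupSize_le (K - L)
  rw [Nat.cast_sub hLK] at h
  rw [div_le_div_iff₀ (by positivity) (by positivity)]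
  nlinarith
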